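/- Let $1/\Gamma$ denote the entire function which is the reciprocal of the Gamma function (so it vanishes at $0,-1,-2,\dots$). For every $u\in\mathbb{C}$ and every real $v\neq 0$, the power series $$\sum_{n\ge 0}\frac{z^n}{\Gamma\!\left(u+\frac{2ivn}{\pi}\right)}$$ has the circle $|z|=e^{-|v|}$ as its natural boundary: its radius of convergence is $e^{-|v|}$, and for no point $w$ with $|w|=e^{-|v|}$ is there a function holomorphic in a neighbourhood of $w$ which agrees with the sum of the series at all points of that neighbourhood with $|z|<e^{-|v|}$. In particular ($u=1$, $v=\pi/2$), the power series $1+\frac{z}{\Gamma(1+i)}+\frac{z^2}{\Gamma(1+2i)}+\frac{z^3}{\Gamma(1+3i)}+\cdots$ has the circle $|z|=e^{-\pi/2}$ as its natural boundary. -/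

import Mathlib

/-- The sum `∑_{n ≥ 0} a n * z ^ n` of the power series with coefficients `a`. -/
noncomputable def powerSeriesSum (a : ℕ → ℂ) (z : ℂ) : ℂ := ∑' n : ℕ, a n * z ^ n

/-- A point `w` is a regular point of the power series with coefficients `a`, relative to the
disc `|z| < R`, if the sum of the series in that disc agrees, near `w`, with a function that is
holomorphic in a whole neighbourhood of `w`. -/
def IsRegularPoint (a : ℕ → ℂ) (R : ℝ) (w : ℂ) : Prop :=
  ∃ r : ℝ, 0 < r ∧ ∃ g : ℂ → ℂ, AnalyticOnNhd ℂ g (Metric.ball w r) ∧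
    ∀ z ∈ Metric.ball w r ∩ Metric.ball 0 R, g z = powerSeriesSum a z

/-- The circle `|z| = R` (with `R > 0`) is the natural boundary of the power series with
coefficients `a`: the radius of convergence is exactly `R`, and no point of the circle is
regular, i.e. the sum does not continue analytically across any point of the circle. -/
def HasNaturalBoundaryCircle (a : ℕ → ℂ) (R : ℝ) : Prop :=
  0 < R ∧
  (FormalMultilinearSeries.ofScalars ℂ a).radius = ENNReal.ofReal R ∧
  ∀ w : ℂ, ‖w‖ = R → ¬ IsRegularPoint a R w

open Filter Topology Asymptotics

/-! With `c = 2v/π`, the ratios of consecutive coefficients are `(ic)^(-ic) * exp(-ic log n) * (1 +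
O(1/n))`. The modulus of `(ic)^(-ic)` is `exp(|c|π/2)`, which gives the radius; the phase `c log n`
turns ever more slowly, but without bound.

Let `w` be on the circle and `b n = a n * w ^ n`. Then `|b (n+1) / b n| = 1 + O(1/n)`, and the phase
of this ratio is close to `0` on arbitrarily long blocks starting at suitable `N`, so `b (N + j) / b
N → 1` for each fixed `j`. Inside the disc the normalized remainders `(g z - ∑_{m<N} b m z^m) / (b N
z^N)` therefore tend to `1/(1 - z)` along these `N`.

If `g` were holomorphic near `1`, these remainders would be bounded near `1` uniformly in `N`: the
ratio bounds control them by a power of `1/|1 - |z||` on both sides of the circle, and a maximum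
principle removes the singularity (`norm_le_of_norm_mul_abs_norm_sq_sub_one_pow_le`). But `1/(1 -
z)` is unbounded near `1`. This is `not_isRegularPoint_one_of_tendsto_div`; its input for Gamma is
`Complex.exists_norm_Gamma_add_div_Gamma_sub_one_le`. -/

/-! ### Asymptotics of Gamma quotients off the real axis -/

/-- Both points lie in the same open half-plane, so their arguments differ by less than `π` and no
multiple of `2πi` appears. -/
theorem Complex.log_add_one_sub_log {z : ℂ} (hz : z.im ≠ 0) :
    Complex.log (z + 1) - Complex.log z = Complex.log (1 + z⁻¹) := by
  have hz0 : z ≠ 0 := by rintro rfl; simp at hz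
  have hz1 : z + 1 ≠ 0 := by
    intro h
    have := congrArg Complex.im h
    simp at this
    exact hz this
  have him : (z + 1).im = z.im := by simp
  have h : Complex.exp (Complex.log (z + 1) - Complex.log z) = 1 + z⁻¹ := by
    rw [Complex.exp_sub, Complex.exp_log hz1, Complex.exp_log hz0]
    field_simp
  rw [← h, Complex.log_exp]
  · simp only [Complex.sub_im, Complex.log_im]
    rcases lt_or_gt_of_ne hz with h0 | h0
    · have h1 := Complex.neg_pi_lt_arg (z + 1)
      have h2 := Complex.arg_neg_iff.2 h0
      linarith
    · have h1 := Complex.arg_nonneg_iff.2 (him ▸ h0.le : 0 ≤ (z + 1).im)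
      have h2 := Complex.arg_lt_pi_iff.2 (Or.inr hz)
      linarith
  · simp only [Complex.sub_im, Complex.log_im]
    rcases lt_or_gt_of_ne hz with h0 | h0
    · have h1 := Complex.arg_neg_iff.2 (him.symm ▸ h0 : (z + 1).im < 0)
      have h2 := Complex.neg_pi_lt_arg z
      linarith
    · have h1 := Complex.arg_le_pi (z + 1)
      have h2 := Complex.arg_nonneg_iff.2 h0.le
      linarith

theorem Complex.isBigO_log_one_add_sub :
    (fun h : ℂ => Complex.log (1 + h) - h) =O[𝓝 0] fun h => h ^ 2 := by
  refine IsBigO.of_bound 1 ?_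
  filter_upwards [Metric.ball_mem_nhds (0 : ℂ) (by norm_num : (0 : ℝ) < 1 / 2)] with h hh
  have hh' : ‖h‖ < 1 / 2 := by simpa using hh
  refine (Complex.norm_log_one_add_sub_self_le (by linarith)).trans ?_
  rw [norm_pow, one_mul, mul_div_assoc]
  refine mul_le_of_le_one_right (by positivity) ?_
  have : (1 - ‖h‖)⁻¹ ≤ 2 := by
    rw [inv_le_comm₀ (by linarith) (by norm_num)]
    linarith
  linarith

/-- The linear terms `a * h` cancel. With `h = (s + k)⁻¹` this is one factor of the Euler product
for `Γ(s + a) / Γ(s) * s^(-a)`, and the second order makes the product converge. -/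
theorem Complex.isBigO_exp_mul_log_div (a : ℂ) :
    (fun h : ℂ => Complex.exp (a * Complex.log (1 + h)) / (1 + a * h) - 1)
      =O[𝓝 0] fun h => h ^ 2 := by
  have hlog := Complex.isBigO_log_one_add_sub
  have hsq : (fun h : ℂ => h ^ 2) =O[𝓝 0] fun h => h := by
    simpa using (isLittleO_pow_pow (𝕜 := ℂ) (m := 1) (n := 2) (by norm_num)).isBigO
  have hlog' : (fun h : ℂ => a * Complex.log (1 + h)) =O[𝓝 0] fun h => h := by
    have := ((hlog.trans hsq).add (isBigO_refl (fun h : ℂ => h) (𝓝 0))).const_mul_left a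
    simpa using this
  have hexp : (fun x : ℂ => Complex.exp x - 1 - x) =O[𝓝 0] fun x => x ^ 2 := by
    refine IsBigO.of_bound 1 ?_
    filter_upwards [Metric.ball_mem_nhds (0 : ℂ) one_pos] with x hx
    have hx' : ‖x‖ < 1 := by simpa using hx
    simpa using Complex.norm_exp_sub_one_sub_id_le hx'.le
  have ht : Tendsto (fun h : ℂ => a * Complex.log (1 + h)) (𝓝 0) (𝓝 0) :=
    hlog'.trans_tendsto tendsto_id
  have h1 : (fun h : ℂ => Complex.exp (a * Complex.log (1 + h)) - (1 + a * h))
      =O[𝓝 0] fun h => h ^ 2 := by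
    have h2 := (hexp.comp_tendsto ht).trans (hlog'.pow 2)
    refine (h2.add (hlog.const_mul_left a)).congr_left fun h => ?_
    simp only [Function.comp_apply]
    ring
  have hden : Tendsto (fun h : ℂ => 1 + a * h) (𝓝 0) (𝓝 1) := by
    have : ContinuousAt (fun h : ℂ => 1 + a * h) 0 := by fun_prop
    simpa [ContinuousAt] using this
  have hinv : (fun h : ℂ => (1 + a * h)⁻¹) =O[𝓝 0] fun _ => (1 : ℂ) :=
    (hden.inv₀ one_ne_zero).isBigO_one ℂ
  have h3 := h1.mul hinv
  simp only [mul_one] at h3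
  refine h3.congr' ?_ EventuallyEq.rfl
  filter_upwards [hden.eventually_ne one_ne_zero] with h hh
  rw [← div_eq_mul_inv, sub_div, div_self hh]

theorem sum_range_inv_add_sq_le {t : ℝ} (ht : 1 < t) (n : ℕ) :
    ∑ k ∈ Finset.range n, ((k + t) ^ 2)⁻¹ ≤ (t - 1)⁻¹ := by
  suffices h : ∑ k ∈ Finset.range n, ((k + t) ^ 2)⁻¹ ≤ (t - 1)⁻¹ - (n + t - 1)⁻¹ by
    have : 0 < (n + t - 1)⁻¹ := inv_pos.2 (by have := n.cast_nonneg (α := ℝ); linarith)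
    linarith
  induction n with
  | zero => simp
  | succ n ih =>
    rw [Finset.sum_range_succ]
    have hn := n.cast_nonneg (α := ℝ)
    have h1 : 0 < n + t - 1 := by linarith
    have h2 : 0 < n + t := by linarith
    have : (((n : ℝ) + t) ^ 2)⁻¹ ≤ (n + t - 1)⁻¹ - (n + t)⁻¹ := by
      rw [inv_sub_inv h1.ne' h2.ne', inv_eq_one_div]
      refine (div_le_div_iff₀ (by positivity) (by positivity)).2 ?_
      nlinarith
    push_cast
    have e : (n : ℝ) + 1 + t - 1 = n + t := by ring
    rw [e]
    linarith

/-- In this sector `|Re s + k| + |Im s| ≥ k + |Im s| / 2`, which reduces the sum to a telescoping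
real one. -/
theorem Complex.sum_range_norm_add_natCast_inv_sq_le {s : ℂ} (hs : 2 * |s.re| ≤ |s.im|)
    (hs' : 4 ≤ |s.im|) (n : ℕ) :
    ∑ k ∈ Finset.range n, ‖(s + k)⁻¹‖ ^ 2 ≤ 8 / |s.im| := by
  set y := |s.im| with hy
  have hk (k : ℕ) : ‖(s + k)⁻¹‖ ^ 2 ≤ 2 * (((k : ℝ) + y / 2) ^ 2)⁻¹ := by
    have hk0 := k.cast_nonneg (α := ℝ)
    rw [norm_inv, inv_pow, ← Complex.normSq_eq_norm_sq, Complex.normSq_apply]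
    simp only [Complex.add_re, Complex.natCast_re, Complex.add_im, Complex.natCast_im, add_zero]
    rw [← abs_mul_abs_self s.im, ← hy, ← abs_mul_abs_self (s.re + k)]
    have h1 : k - y / 2 ≤ |s.re + k| := by
      have := neg_abs_le s.re
      have := le_abs_self (s.re + k)
      linarith
    have h2 : ((k : ℝ) + y / 2) ^ 2 ≤ (|s.re + k| + y) ^ 2 := by
      refine pow_le_pow_left₀ (by linarith) (by linarith) 2
    have h3 : 0 < ((k : ℝ) + y / 2) ^ 2 := by positivity
    have h4 : ((k : ℝ) + y / 2) ^ 2 / 2 ≤ |s.re + k| * |s.re + k| + y * y := by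
      nlinarith [sq_nonneg (|s.re + k| - y)]
    calc _ ≤ (((k : ℝ) + y / 2) ^ 2 / 2)⁻¹ := inv_anti₀ (by linarith) h4
      _ = _ := by rw [inv_div]; rfl
  calc _ ≤ ∑ k ∈ Finset.range n, 2 * (((k : ℝ) + y / 2) ^ 2)⁻¹ := Finset.sum_le_sum fun k _ => hk k
    _ = 2 * ∑ k ∈ Finset.range n, (((k : ℝ) + y / 2) ^ 2)⁻¹ := by rw [Finset.mul_sum]
    _ ≤ 2 * (y / 2 - 1)⁻¹ := by
      gcongr
      exact sum_range_inv_add_sq_le (by linarith) n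
    _ ≤ 8 / y := by
      rw [← div_eq_mul_inv, div_le_div_iff₀ (by linarith) (by linarith)]
      linarith

theorem Complex.prod_range_div_mul_exp_log_sub (s a : ℂ) (n : ℕ) :
    ∏ k ∈ Finset.range n, ((s + k) / (s + k + a) *
        Complex.exp (a * (Complex.log (s + k + 1) - Complex.log (s + k)))) =
      (∏ k ∈ Finset.range n, (s + k)) / (∏ k ∈ Finset.range n, (s + a + k)) *
        Complex.exp (a * (Complex.log (s + n) - Complex.log s)) := by
  induction n with
  | zero => simp
  | succ n ih =>
    rw [Finset.prod_range_succ, ih, Finset.prod_range_succ, Finset.prod_range_succ]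
    have e : a * (Complex.log (s + (n + 1 : ℕ)) - Complex.log s) =
        a * (Complex.log (s + n) - Complex.log s) +
          a * (Complex.log (s + n + 1) - Complex.log (s + n)) := by
      push_cast
      rw [← add_assoc]
      ring
    rw [e, Complex.exp_add, mul_div_mul_comm, add_right_comm s a]
    ring

theorem Complex.add_natCast_ne_zero_of_im_ne_zero {s : ℂ} (hs : s.im ≠ 0) (k : ℕ) :
    s + k ≠ 0 := by
  intro h
  have := congrArg Complex.im h
  simp at this
  exact hs this

theorem Complex.tendsto_log_add_natCast_sub_log {s : ℂ} (hs : s.im ≠ 0) :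
    Tendsto (fun n : ℕ => Complex.log (s + n) - Complex.log n) atTop (𝓝 0) := by
  have h1 : Tendsto (fun n : ℕ => 1 + s / (n : ℂ)) atTop (𝓝 1) := by
    simpa using (tendsto_const_div_atTop_nhds_zero_nat s).const_add 1
  have h2 := h1.clog (by simp [Complex.slitPlane])
  rw [Complex.log_one] at h2
  refine h2.congr' ?_
  filter_upwards [eventually_gt_atTop 0] with n hn
  have hn0 : (n : ℂ) ≠ 0 := by exact_mod_cast hn.ne'
  have hsn := Complex.add_natCast_ne_zero_of_im_ne_zero hs n
  have e : s + n = ((n : ℝ) : ℂ) * (1 + s / n) := by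
    push_cast
    field_simp
    ring
  rw [e, Complex.log_ofReal_mul (by exact_mod_cast hn)]
  · rw [← Complex.ofReal_natCast n, ← Complex.ofReal_log (Nat.cast_nonneg n)]
    ring
  · rw [e] at hsn
    exact right_ne_zero_of_mul hsn

theorem Complex.Gamma_ne_zero_of_im_ne_zero {s : ℂ} (hs : s.im ≠ 0) : Complex.Gamma s ≠ 0 :=
  Complex.Gamma_ne_zero fun m h => hs (by simp [h])

/-- The logarithms telescope, so the product is the quotient of Euler's approximants `GammaSeq` at
`s + a` and `s`, with `n ^ a` replaced by `(s + n + 1) ^ a`, times `s ^ (-a)`. The `n + 1` factors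
match the denominator of `GammaSeq`. -/
theorem Complex.tendsto_prod_Gamma_div {s a : ℂ} (hs : s.im ≠ 0) (hsa : (s + a).im ≠ 0) :
    Tendsto (fun n : ℕ => ∏ k ∈ Finset.range (n + 1), ((s + k) / (s + k + a) *
        Complex.exp (a * (Complex.log (s + k + 1) - Complex.log (s + k))))) atTop
      (𝓝 (Complex.Gamma (s + a) / Complex.Gamma s * Complex.exp (-(a * Complex.log s)))) := by
  have h1 := (Complex.GammaSeq_tendsto_Gamma (s + a)).div (Complex.GammaSeq_tendsto_Gamma s)
    (Complex.Gamma_ne_zero_of_im_ne_zero hs)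
  have h2 : Tendsto (fun n : ℕ => Complex.exp (a * (Complex.log (s + 1 + n) - Complex.log n)))
      atTop (𝓝 1) := by
    have h := (Complex.tendsto_log_add_natCast_sub_log (s := s + 1) (by simpa using hs)).const_mul a
    simpa using h.cexp
  have h3 := (h1.mul h2).mul_const (Complex.exp (-(a * Complex.log s)))
  rw [mul_one] at h3
  refine h3.congr' ?_
  filter_upwards [eventually_gt_atTop 0] with n hn
  have hn0 : (n : ℂ) ≠ 0 := by exact_mod_cast hn.ne'
  rw [Complex.prod_range_div_mul_exp_log_sub]
  have p1 : ∏ k ∈ Finset.range (n + 1), (s + k) ≠ 0 :=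
    Finset.prod_ne_zero_iff.2 fun k _ => Complex.add_natCast_ne_zero_of_im_ne_zero hs k
  have p2 : ∏ k ∈ Finset.range (n + 1), (s + a + k) ≠ 0 :=
    Finset.prod_ne_zero_iff.2 fun k _ => Complex.add_natCast_ne_zero_of_im_ne_zero hsa k
  have hf : (n.factorial : ℂ) ≠ 0 := by exact_mod_cast n.factorial_ne_zero
  have hc : (n : ℂ) ^ s ≠ 0 := by simp [Complex.cpow_eq_zero_iff, hn0]
  have e : a * (Complex.log (s + (n + 1 : ℕ)) - Complex.log s) = Complex.log n * a +
      a * (Complex.log (s + 1 + n) - Complex.log n) + -(a * Complex.log s) := by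
    push_cast
    rw [add_right_comm s 1, ← add_assoc]
    ring
  rw [Pi.div_apply, Complex.GammaSeq, Complex.GammaSeq, Complex.cpow_add _ _ hn0,
    Complex.cpow_def_of_ne_zero hn0 a, e, Complex.exp_add, Complex.exp_add]
  field_simp

theorem Complex.exists_norm_Gamma_add_div_Gamma_sub_one_le (a : ℂ) :
    ∃ C Y : ℝ, 0 < C ∧ 0 < Y ∧ ∀ s : ℂ, Y ≤ |s.im| → 2 * |s.re| ≤ |s.im| →
      ‖Complex.Gamma (s + a) / Complex.Gamma s * Complex.exp (-(a * Complex.log s)) - 1‖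
        ≤ C / |s.im| := by
  obtain ⟨C, hC, hb⟩ := (Complex.isBigO_exp_mul_log_div a).exists_pos
  obtain ⟨δ, hδ, hb⟩ := Metric.eventually_nhds_iff_ball.1 hb.bound
  -- In the threshold, `4` serves the sum bound, `2 / δ` puts `(s + k)⁻¹` in the `δ`-ball, `|a.im|`
  -- keeps `s + a` off the real axis, and `8 * C` makes the exponent `x = 8 * C / |s.im|` at most
  -- `1`, so that `exp x - 1 ≤ 2 * x`; hence `16 * C`.
  refine ⟨16 * C, 4 + 2 / δ + |a.im| + 8 * C, by positivity, by positivity, fun s hY hs => ?_⟩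
  have hd : 0 < 2 / δ := by positivity
  have hY4 : 4 ≤ |s.im| := by linarith [abs_nonneg a.im]
  have hYpos : 0 < |s.im| := by linarith
  have him : s.im ≠ 0 := abs_pos.1 hYpos
  have hima : (s + a).im ≠ 0 := by
    intro h
    rw [Complex.add_im] at h
    have : |s.im| = |a.im| := by rw [eq_neg_of_add_eq_zero_left h, abs_neg]
    linarith
  refine le_of_tendsto' ((Complex.tendsto_prod_Gamma_div him hima).sub_const 1).norm fun n => ?_
  have hk (k : ℕ) : ‖(s + k) / (s + k + a) *
      Complex.exp (a * (Complex.log (s + k + 1) - Complex.log (s + k))) - 1‖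
        ≤ C * ‖(s + k)⁻¹‖ ^ 2 := by
    have hsk : (s + k).im ≠ 0 := by simpa using him
    have h0 := Complex.add_natCast_ne_zero_of_im_ne_zero him k
    have hball : (s + k)⁻¹ ∈ Metric.ball (0 : ℂ) δ := by
      rw [mem_ball_zero_iff, norm_inv, inv_lt_comm₀ (norm_pos_iff.2 h0) hδ]
      have h1 := Complex.abs_im_le_norm (s + k)
      simp only [Complex.add_im, Complex.natCast_im, add_zero] at h1
      have h2 : δ⁻¹ ≤ 2 / δ := by
        rw [div_eq_mul_inv]
        linarith [inv_pos.2 hδ]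
      linarith [abs_nonneg a.im]
    have := hb _ hball
    rw [norm_pow] at this
    rw [Complex.log_add_one_sub_log hsk]
    convert this using 3
    rw [mul_comm, mul_div_assoc', div_eq_div_iff]
    · field_simp
    · have := Complex.add_natCast_ne_zero_of_im_ne_zero hima k
      rwa [add_right_comm] at this
    · have := Complex.add_natCast_ne_zero_of_im_ne_zero hima k
      rw [add_right_comm] at this
      rw [← div_eq_mul_inv]
      intro h
      apply this
      field_simp at h
      simpa using h
  have h1 := Finset.norm_prod_one_add_sub_one_le (Finset.range (n + 1)) fun k : ℕ =>
    (s + k) / (s + k + a) * Complex.exp (a * (Complex.log (s + k + 1) - Complex.log (s + k))) - 1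
  simp only [add_sub_cancel] at h1
  have h2 : ∑ k ∈ Finset.range (n + 1), ‖(s + k) / (s + k + a) *
      Complex.exp (a * (Complex.log (s + k + 1) - Complex.log (s + k))) - 1‖ ≤ 8 * C / |s.im| := by
    refine (Finset.sum_le_sum fun k _ => hk k).trans ?_
    rw [← Finset.mul_sum]
    refine (mul_le_mul_of_nonneg_left
      (Complex.sum_range_norm_add_natCast_inv_sq_le hs hY4 (n + 1)) hC.le).trans (le_of_eq ?_)
    ring
  have h3 : 8 * C / |s.im| ≤ 1 := by
    rw [div_le_one hYpos]
    linarith [abs_nonneg a.im]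
  have h4 : 0 ≤ 8 * C / |s.im| := by positivity
  have h5 := Real.abs_exp_sub_one_le (abs_le.2 ⟨by linarith, h3⟩)
  rw [abs_of_nonneg h4] at h5
  calc _ ≤ _ := h1
    _ ≤ Real.exp (8 * C / |s.im|) - 1 := by gcongr
    _ ≤ 2 * (8 * C / |s.im|) := (le_abs_self _).trans h5
    _ = _ := by ring

/-! ### Growth of coefficients with ratios `1 + O(1/n)` -/

/-- The binomials are the extremal sequence for ratios `1 + K / (j + 1)`, and their generating
function is `(1 - x) ^ (-(K + 1))`. Starting the recurrence at a later index only lowers the ratios,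
so the bounds that follow are uniform in `n`. -/
theorem choose_add_succ_eq (j K : ℕ) :
    (((j + 1 + K).choose K : ℕ) : ℝ) = (1 + K / (j + 1)) * ((j + K).choose K : ℕ) := by
  have h := Nat.add_one_mul_choose_eq (j + K) j
  rw [Nat.choose_symm_add, show j + K + 1 = j + 1 + K by ring, Nat.choose_symm_add] at h
  have h' : ((j : ℝ) + 1 + K) * ((j + K).choose K : ℕ) = ((j + 1 + K).choose K : ℕ) * (j + 1) := by
    exact_mod_cast h
  have : (j : ℝ) + 1 ≠ 0 := by positivity
  field_simp
  linarith

theorem one_add_div_mul_choose_le (n j K : ℕ) :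
    (1 + (K : ℝ) / ((n + j : ℕ) + 1)) * ((j + K).choose K : ℕ) ≤ ((j + 1 + K).choose K : ℕ) := by
  rw [choose_add_succ_eq]
  gcongr
  linarith [n.cast_nonneg (α := ℝ)]

theorem norm_add_le_choose_mul {b : ℕ → ℂ} {K n₀ : ℕ}
    (h : ∀ n ≥ n₀, ‖b (n + 1)‖ ≤ (1 + K / (n + 1)) * ‖b n‖) {n : ℕ} (hn : n₀ ≤ n) (j : ℕ) :
    ‖b (n + j)‖ ≤ ((j + K).choose K : ℕ) * ‖b n‖ := by
  induction j with
  | zero => simp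
  | succ j ih =>
    calc ‖b (n + (j + 1))‖ ≤ (1 + K / ((n + j : ℕ) + 1)) * ‖b (n + j)‖ := h (n + j) (by omega)
      _ ≤ (1 + K / ((n + j : ℕ) + 1)) * (((j + K).choose K : ℕ) * ‖b n‖) := by gcongr
      _ = ((1 + K / ((n + j : ℕ) + 1)) * ((j + K).choose K : ℕ)) * ‖b n‖ := by ring
      _ ≤ _ := by
        gcongr
        exact one_add_div_mul_choose_le n j K

theorem norm_le_choose_mul_norm_add {b : ℕ → ℂ} {K n₀ : ℕ}
    (h : ∀ n ≥ n₀, ‖b n‖ ≤ (1 + K / (n + 1)) * ‖b (n + 1)‖) {n : ℕ} (hn : n₀ ≤ n) (j : ℕ) :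
    ‖b n‖ ≤ ((j + K).choose K : ℕ) * ‖b (n + j)‖ := by
  induction j with
  | zero => simp
  | succ j ih =>
    calc ‖b n‖ ≤ ((j + K).choose K : ℕ) * ‖b (n + j)‖ := ih
      _ ≤ ((j + K).choose K : ℕ) * ((1 + K / ((n + j : ℕ) + 1)) * ‖b (n + j + 1)‖) := by
        gcongr
        exact h (n + j) (by omega)
      _ = ((1 + K / ((n + j : ℕ) + 1)) * ((j + K).choose K : ℕ)) * ‖b (n + (j + 1))‖ := by
        rw [add_assoc]; ring
      _ ≤ _ := by
        gcongr
        exact one_add_div_mul_choose_le n j K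

/-! ### A maximum principle across the unit circle -/

/-- Since `ρ ^ 2` is `ζ` times its conjugate, the polynomial is `ζ` times the real number `‖1 + ζ‖ ^
2 - 1`. On a small circle around `1` the non-holomorphic weight thus becomes the modulus of a
polynomial. -/
theorem norm_sq_add_mul_add_of_norm_eq {ζ : ℂ} {ρ : ℝ} (h : ‖ζ‖ = ρ) :
    ‖ζ ^ 2 + ρ ^ 2 * ζ + ρ ^ 2‖ = ρ * |‖1 + ζ‖ ^ 2 - 1| := by
  have h2 : ζ * (starRingEnd ℂ) ζ = (ρ : ℂ) ^ 2 := by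
    rw [Complex.mul_conj, Complex.normSq_eq_norm_sq, h]
    push_cast
    rfl
  have h3 : ((‖1 + ζ‖ ^ 2 - 1 : ℝ) : ℂ) = ζ + (starRingEnd ℂ) ζ + ρ ^ 2 := by
    have := Complex.mul_conj (1 + ζ)
    rw [Complex.normSq_eq_norm_sq] at this
    push_cast at this ⊢
    rw [← this, ← h2, map_add, map_one]
    ring
  have h4 : ζ ^ 2 + ρ ^ 2 * ζ + ρ ^ 2 = ζ * ((‖1 + ζ‖ ^ 2 - 1 : ℝ) : ℂ) := by
    rw [h3, mul_add, mul_add, h2]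
    ring
  rw [h4, norm_mul, h, Complex.norm_real, Real.norm_eq_abs]

/-- Maximum principle for `Q ^ p * F`: the zeros of `Q` on the boundary absorb the blow-up of `F`
where that circle meets the unit circle, while near the centre `Q` stays close to `ρ ^ 2`. -/
theorem norm_le_of_norm_mul_abs_norm_sq_sub_one_pow_le {F : ℂ → ℂ} {ρ A : ℝ} {p : ℕ}
    (hρ : 0 < ρ) (hρ' : ρ ≤ 1) (hF : DiffContOnCl ℂ F (Metric.ball 1 ρ))
    (hA : ∀ z ∈ Metric.sphere (1 : ℂ) ρ, ‖F z‖ * |‖z‖ ^ 2 - 1| ^ p ≤ A)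
    {z : ℂ} (hz : ‖z - 1‖ ≤ ρ / 4) : ‖F z‖ ≤ A * (2 / ρ) ^ p := by
  set Q : ℂ → ℂ := fun z => (z - 1) ^ 2 + ρ ^ 2 * (z - 1) + ρ ^ 2 with hQ
  have hQd : Differentiable ℂ fun z => Q z ^ p := by fun_prop
  have hG : DiffContOnCl ℂ (fun z => Q z ^ p * F z) (Metric.ball 1 ρ) := by
    simpa only [smul_eq_mul] using hQd.diffContOnCl.smul hF
  have hfr : ∀ z ∈ frontier (Metric.ball (1 : ℂ) ρ), ‖Q z ^ p * F z‖ ≤ ρ ^ p * A := by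
    intro z hz
    rw [frontier_ball _ hρ.ne'] at hz
    have h1 : ‖Q z‖ = ρ * |‖z‖ ^ 2 - 1| := by
      have := norm_sq_add_mul_add_of_norm_eq (mem_sphere_iff_norm.1 hz)
      rwa [add_sub_cancel] at this
    rw [norm_mul, norm_pow, h1, mul_pow, mul_assoc, mul_comm (_ ^ p) ‖F z‖]
    gcongr
    exact hA z hz
  have hzc : z ∈ closure (Metric.ball (1 : ℂ) ρ) := by
    rw [closure_ball _ hρ.ne', mem_closedBall_iff_norm]
    linarith
  have hmax := Complex.norm_le_of_forall_mem_frontier_norm_le Metric.isBounded_ball hG hfr hzc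
  have hQz : ρ ^ 2 / 2 ≤ ‖Q z‖ := by
    have h1 : ‖(z - 1) ^ 2 + (ρ : ℂ) ^ 2 * (z - 1)‖ ≤ (ρ / 4) ^ 2 + ρ ^ 2 * (ρ / 4) := by
      refine (norm_add_le _ _).trans ?_
      rw [norm_mul, norm_pow, norm_pow, Complex.norm_real, Real.norm_of_nonneg hρ.le]
      gcongr
    have h2 : ‖(ρ : ℂ) ^ 2‖ = ρ ^ 2 := by
      rw [norm_pow, Complex.norm_real, Real.norm_of_nonneg hρ.le]
    have h3 : ‖(ρ : ℂ) ^ 2‖ - ‖(z - 1) ^ 2 + (ρ : ℂ) ^ 2 * (z - 1)‖ ≤ ‖Q z‖ := by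
      rw [show Q z = (ρ : ℂ) ^ 2 + ((z - 1) ^ 2 + (ρ : ℂ) ^ 2 * (z - 1)) from add_comm _ _]
      exact norm_sub_le_norm_add ((ρ : ℂ) ^ 2) ((z - 1) ^ 2 + (ρ : ℂ) ^ 2 * (z - 1))
    nlinarith [sq_nonneg ρ]
  have hpos : 0 < (ρ ^ 2 / 2) ^ p := by positivity
  have h5 : (ρ ^ 2 / 2) ^ p * ‖F z‖ ≤ ρ ^ p * A := by
    rw [norm_mul, norm_pow] at hmax
    refine le_trans ?_ hmax
    gcongr
  calc ‖F z‖ = ((ρ ^ 2 / 2) ^ p * ‖F z‖) / (ρ ^ 2 / 2) ^ p := by field_simp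
    _ ≤ ρ ^ p * A / (ρ ^ 2 / 2) ^ p := by gcongr
    _ = A * (2 / ρ) ^ p := by
      rw [mul_comm, mul_div_assoc, ← div_pow]
      congr 2
      field_simp

/-! ### Normalized remainders on both sides of the unit circle -/

theorem summable_mul_pow_of_norm_succ_le {b : ℕ → ℂ} {K n₀ : ℕ}
    (h : ∀ n ≥ n₀, ‖b (n + 1)‖ ≤ (1 + K / (n + 1)) * ‖b n‖) {z : ℂ} (hz : ‖z‖ < 1) :
    Summable fun n => b n * z ^ n := by
  rw [← summable_nat_add_iff n₀]
  have hs := (hasSum_choose_mul_geometric_of_norm_lt_one K (r := ‖z‖) (by simpa using hz)).summable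
  refine Summable.of_norm_bounded (hs.mul_left (‖b n₀‖ * ‖z‖ ^ n₀)) fun j => ?_
  have := norm_add_le_choose_mul h le_rfl (n := n₀) j
  rw [norm_mul, norm_pow, add_comm j n₀, pow_add]
  calc _ ≤ (((j + K).choose K : ℕ) * ‖b n₀‖) * (‖z‖ ^ n₀ * ‖z‖ ^ j) := by gcongr
    _ = _ := by ring

theorem sum_range_choose_mul_pow_le {K : ℕ} {x : ℝ} (hx0 : 0 ≤ x) (hx : x < 1) (n : ℕ) :
    ∑ j ∈ Finset.range n, ((j + K).choose K : ℕ) * x ^ j ≤ 1 / (1 - x) ^ (K + 1) := by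
  have hs := hasSum_choose_mul_geometric_of_norm_lt_one K (r := x)
    (by rwa [Real.norm_of_nonneg hx0])
  exact sum_le_hasSum _ (fun j _ => by positivity) hs

/-- The remainder `(g z - ∑_{m < N} b m z ^ m) / (b N z ^ N)` of a power series. -/
noncomputable def normalizedRemainder (b : ℕ → ℂ) (g : ℂ → ℂ) (N : ℕ) (z : ℂ) : ℂ :=
  (g z - ∑ m ∈ Finset.range N, b m * z ^ m) / (b N * z ^ N)

theorem hasSum_normalizedRemainder {b : ℕ → ℂ} {g : ℂ → ℂ} {K n₀ N : ℕ} {z : ℂ}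
    (h : ∀ n ≥ n₀, ‖b (n + 1)‖ ≤ (1 + K / (n + 1)) * ‖b n‖)
    (hz : ‖z‖ < 1) (hz0 : z ≠ 0) (hbN : b N ≠ 0) (hg : g z = ∑' n, b n * z ^ n) :
    HasSum (fun j => b (N + j) / b N * z ^ j) (normalizedRemainder b g N z) := by
  have hs := (summable_mul_pow_of_norm_succ_le h hz).hasSum
  rw [← hg, ← hasSum_nat_add_iff' N] at hs
  have h2 := hs.div_const (b N * z ^ N)
  refine h2.congr_fun fun j => ?_
  rw [add_comm j N, pow_add]
  field_simp

theorem norm_normalizedRemainder_le_of_lt_one {b : ℕ → ℂ} {g : ℂ → ℂ} {K n₀ N : ℕ} {z : ℂ}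
    (h : ∀ n ≥ n₀, ‖b (n + 1)‖ ≤ (1 + K / (n + 1)) * ‖b n‖) (hN : n₀ ≤ N)
    (hz : ‖z‖ < 1) (hz0 : z ≠ 0) (hbN : b N ≠ 0) (hg : g z = ∑' n, b n * z ^ n) :
    ‖normalizedRemainder b g N z‖ ≤ 1 / (1 - ‖z‖) ^ (K + 1) := by
  rw [← (hasSum_normalizedRemainder h hz hz0 hbN hg).tsum_eq]
  refine tsum_of_norm_bounded
    (hasSum_choose_mul_geometric_of_norm_lt_one K (r := ‖z‖) (by simpa using hz)) fun j => ?_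
  rw [norm_mul, norm_div, norm_pow]
  gcongr
  rw [div_le_iff₀ (norm_pos_iff.2 hbN)]
  exact norm_add_le_choose_mul h hN j

/-- Outside the disc the remainder is read backwards: relative to `b N * z ^ N`, the term `d` places
earlier is at most a binomial times `‖z‖⁻¹ ^ d`. The part of `g` not covered by these terms is
bounded by `M`. -/
theorem norm_normalizedRemainder_le_of_one_lt {b : ℕ → ℂ} {g : ℂ → ℂ} {K n₀ N : ℕ} {z : ℂ} {M : ℝ}
    (h : ∀ n ≥ n₀, ‖b n‖ ≤ (1 + K / (n + 1)) * ‖b (n + 1)‖) (hN : n₀ ≤ N)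
    (hz : 1 < ‖z‖) (hb : b n₀ ≠ 0) (hbN : b N ≠ 0)
    (hM : ‖g z - ∑ m ∈ Finset.range n₀, b m * z ^ m‖ ≤ M) :
    ‖normalizedRemainder b g N z‖ ≤ (1 + M / ‖b n₀‖) * (1 / (1 - ‖z‖⁻¹) ^ (K + 1)) := by
  obtain ⟨L, rfl⟩ := Nat.exists_eq_add_of_le hN
  set x := ‖z‖⁻¹ with hx
  have hz0 : 0 < ‖z‖ := by linarith
  have hx0 : 0 < x := inv_pos.2 hz0
  have hx1 : x < 1 := inv_lt_one_of_one_lt₀ hz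
  set T := 1 / (1 - x) ^ (K + 1) with hT
  have hbL : 0 < ‖b (n₀ + L)‖ := norm_pos_iff.2 hbN
  have hb0 : 0 < ‖b n₀‖ := norm_pos_iff.2 hb
  have hM0 : 0 ≤ M := (norm_nonneg _).trans hM
  have hzx (j : ℕ) : ‖z‖ ^ j * x ^ j = 1 := by
    rw [← mul_pow, hx, mul_inv_cancel₀ hz0.ne', one_pow]
  have hden : (‖b (n₀ + L)‖ * ‖z‖ ^ (n₀ + L))⁻¹ = x ^ (n₀ + L) / ‖b (n₀ + L)‖ := by
    rw [mul_inv, hx, inv_pow, div_eq_mul_inv, mul_comm]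
  have h1 : M * (x ^ (n₀ + L) / ‖b (n₀ + L)‖) ≤ M / ‖b n₀‖ * T := by
    have h2 : ((L + K).choose K : ℕ) * x ^ L ≤ T := by
      refine le_trans ?_ (sum_range_choose_mul_pow_le (K := K) hx0.le hx1 (L + 1))
      exact Finset.single_le_sum (f := fun j => (((j + K).choose K : ℕ) : ℝ) * x ^ j)
        (fun j _ => by positivity) (Finset.self_mem_range_succ L)
    have h3 := norm_le_choose_mul_norm_add h le_rfl L
    have h4 : x ^ (n₀ + L) ≤ x ^ L := pow_le_pow_of_le_one hx0.le hx1.le (by omega)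
    rw [div_mul_eq_mul_div, mul_div_assoc]
    refine mul_le_mul_of_nonneg_left ?_ hM0
    rw [div_le_div_iff₀ hbL hb0]
    calc x ^ (n₀ + L) * ‖b n₀‖ ≤ x ^ L * (((L + K).choose K : ℕ) * ‖b (n₀ + L)‖) := by gcongr
      _ = ((L + K).choose K : ℕ) * x ^ L * ‖b (n₀ + L)‖ := by ring
      _ ≤ _ := by gcongr
  have h2 : ‖∑ i ∈ Finset.range L, b (n₀ + i) * z ^ (n₀ + i)‖ * (x ^ (n₀ + L) / ‖b (n₀ + L)‖)
      ≤ T := by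
    calc _ ≤ (∑ i ∈ Finset.range L, ‖b (n₀ + i) * z ^ (n₀ + i)‖) *
          (x ^ (n₀ + L) / ‖b (n₀ + L)‖) := by
          gcongr
          exact norm_sum_le _ _
      -- After reversal, `j + 1` is the distance of the index from `n₀ + L`.
      _ = ∑ j ∈ Finset.range L, ‖b (n₀ + (L - 1 - j))‖ * ‖z‖ ^ (n₀ + (L - 1 - j)) *
          (x ^ (n₀ + L) / ‖b (n₀ + L)‖) := by
          rw [Finset.sum_mul, ← Finset.sum_range_reflect]
          simp only [norm_mul, norm_pow]
      _ ≤ ∑ j ∈ Finset.range L, ((j + 1 + K).choose K : ℕ) * x ^ (j + 1) := by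
          refine Finset.sum_le_sum fun j hj => ?_
          have hj' := Finset.mem_range.1 hj
          have e : n₀ + L = n₀ + (L - 1 - j) + (j + 1) := by omega
          have h3 := norm_le_choose_mul_norm_add h (n := n₀ + (L - 1 - j)) (by omega) (j + 1)
          rw [← e] at h3
          have e2 : x ^ (n₀ + L) = x ^ (n₀ + (L - 1 - j)) * x ^ (j + 1) := by
            rw [← pow_add, ← e]
          calc _ = ‖b (n₀ + (L - 1 - j))‖ / ‖b (n₀ + L)‖ *
                (‖z‖ ^ (n₀ + (L - 1 - j)) * x ^ (n₀ + (L - 1 - j))) * x ^ (j + 1) := by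
                rw [e2]; ring
            _ ≤ _ := by
                rw [hzx, mul_one]
                gcongr
                rwa [div_le_iff₀ hbL]
      _ ≤ ∑ j ∈ Finset.range (L + 1), ((j + K).choose K : ℕ) * x ^ j := by
          rw [Finset.sum_range_succ']
          have : (0 : ℝ) ≤ ((0 + K).choose K : ℕ) * x ^ 0 := by positivity
          linarith
      _ ≤ T := sum_range_choose_mul_pow_le hx0.le hx1 _
  have e : g z - ∑ m ∈ Finset.range (n₀ + L), b m * z ^ m =
      (g z - ∑ m ∈ Finset.range n₀, b m * z ^ m) -
        ∑ i ∈ Finset.range L, b (n₀ + i) * z ^ (n₀ + i) := by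
    rw [Finset.sum_range_add]
    ring
  rw [normalizedRemainder, e, norm_div, norm_mul, norm_pow, div_eq_mul_inv, hden]
  calc _ ≤ (M + ‖∑ i ∈ Finset.range L, b (n₀ + i) * z ^ (n₀ + i)‖) *
        (x ^ (n₀ + L) / ‖b (n₀ + L)‖) := by
        gcongr
        exact (norm_sub_le _ _).trans (by gcongr)
    _ ≤ _ := by rw [add_mul, add_mul, one_mul]; linarith

theorem norm_normalizedRemainder_mul_le {b : ℕ → ℂ} {g : ℂ → ℂ} {K n₀ N : ℕ} {z : ℂ} {M : ℝ}
    (h : ∀ n ≥ n₀, ‖b (n + 1)‖ ≤ (1 + K / (n + 1)) * ‖b n‖)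
    (h' : ∀ n ≥ n₀, ‖b n‖ ≤ (1 + K / (n + 1)) * ‖b (n + 1)‖) (hN : n₀ ≤ N)
    (hb : b n₀ ≠ 0) (hbN : b N ≠ 0) (hz0 : z ≠ 0) (hz2 : ‖z‖ ≤ 3 / 2)
    (hg : ‖z‖ < 1 → g z = ∑' n, b n * z ^ n)
    (hM : ‖g z - ∑ m ∈ Finset.range n₀, b m * z ^ m‖ ≤ M) :
    ‖normalizedRemainder b g N z‖ * |‖z‖ ^ 2 - 1| ^ (K + 1) ≤
      (1 + M / ‖b n₀‖) * 4 ^ (K + 1) := by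
  have hM0 : 0 ≤ M := (norm_nonneg _).trans hM
  have hC : 1 ≤ 1 + M / ‖b n₀‖ := by
    have : 0 ≤ M / ‖b n₀‖ := by positivity
    linarith
  -- Here `q` is `1 - ‖z‖` inside and `1 - ‖z‖⁻¹` outside; the factor `4` suffices outside because
  -- `‖z‖ * (‖z‖ + 1) ≤ 15 / 4` for `‖z‖ ≤ 3 / 2`. On the unit circle itself the weight vanishes.
  have key {q : ℝ} (hq : 0 < q) (hq4 : |‖z‖ ^ 2 - 1| ≤ 4 * q)
      (hF : ‖normalizedRemainder b g N z‖ ≤ (1 + M / ‖b n₀‖) * (1 / q ^ (K + 1))) :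
      ‖normalizedRemainder b g N z‖ * |‖z‖ ^ 2 - 1| ^ (K + 1) ≤
        (1 + M / ‖b n₀‖) * 4 ^ (K + 1) := by
    calc _ ≤ (1 + M / ‖b n₀‖) * (1 / q ^ (K + 1)) * (4 * q) ^ (K + 1) := by gcongr
      _ = _ := by
        rw [mul_pow]
        field_simp
  have hzn := norm_nonneg z
  rcases lt_trichotomy ‖z‖ 1 with hz | hz | hz
  · refine key (q := 1 - ‖z‖) (by linarith) ?_ ?_
    · rw [abs_le]
      constructor <;> nlinarith
    · refine (norm_normalizedRemainder_le_of_lt_one h hN hz hz0 hbN (hg hz)).trans ?_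
      have : 0 < 1 - ‖z‖ := by linarith
      exact le_mul_of_one_le_left (by positivity) hC
  · rw [hz]
    simp only [one_pow, sub_self, abs_zero, ne_eq, Nat.add_eq_zero_iff, one_ne_zero, and_false,
      not_false_eq_true, zero_pow, mul_zero]
    positivity
  · have hx1 : ‖z‖⁻¹ < 1 := inv_lt_one_of_one_lt₀ hz
    refine key (q := 1 - ‖z‖⁻¹) (by linarith) ?_
      (norm_normalizedRemainder_le_of_one_lt h' hN hz hb hbN hM)
    have e : 1 - ‖z‖⁻¹ = (‖z‖ - 1) / ‖z‖ := by field_simp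
    rw [e, abs_of_nonneg (by nlinarith), ← mul_div_assoc, le_div_iff₀ (by linarith)]
    nlinarith [mul_nonneg (sub_nonneg.2 hz.le) (sub_nonneg.2 hz2)]

/-! ### Criteria for a singular point -/

/-- Regularity at `1` would bound all late normalized remainders near `1` by one constant, yet along
`N k` they converge in the disc to `1 / (1 - z)`. -/
theorem not_isRegularPoint_one_of_tendsto_div {b : ℕ → ℂ} {K n₀ : ℕ}
    (hb : ∀ n ≥ n₀, b n ≠ 0)
    (h : ∀ n ≥ n₀, ‖b (n + 1)‖ ≤ (1 + K / (n + 1)) * ‖b n‖)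
    (h' : ∀ n ≥ n₀, ‖b n‖ ≤ (1 + K / (n + 1)) * ‖b (n + 1)‖)
    {N : ℕ → ℕ} (hN : Tendsto N atTop atTop)
    (hlim : ∀ j, Tendsto (fun k => b (N k + j) / b (N k)) atTop (𝓝 1)) :
    ¬ IsRegularPoint b 1 1 := by
  rintro ⟨r, hr, g, hga, hg⟩
  set ρ := min (1 / 2) (r / 2) with hρ
  have hρ0 : 0 < ρ := by positivity
  have hρ1 : ρ ≤ 1 / 2 := min_le_left _ _
  have hρr : ρ < r := (min_le_right _ _).trans_lt (by linarith)
  have hsub : Metric.closedBall (1 : ℂ) ρ ⊆ Metric.ball 1 r := Metric.closedBall_subset_ball hρr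
  have hz0 : ∀ z ∈ Metric.closedBall (1 : ℂ) ρ, z ≠ 0 := by
    rintro z hz rfl
    rw [mem_closedBall_iff_norm] at hz
    norm_num at hz
    linarith
  have hgs : ∀ z ∈ Metric.closedBall (1 : ℂ) ρ, ‖z‖ < 1 → g z = ∑' n, b n * z ^ n := by
    intro z hz hz1
    exact hg z ⟨hsub hz, by simpa using hz1⟩
  have hgd : DifferentiableOn ℂ g (Metric.ball 1 r) := hga.differentiableOn
  obtain ⟨M, hM⟩ := (isCompact_closedBall (1 : ℂ) ρ).exists_bound_of_continuousOn
    (f := fun z => g z - ∑ m ∈ Finset.range n₀, b m * z ^ m)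
    ((hgd.continuousOn.mono hsub).sub (by fun_prop))
  set A := (1 + M / ‖b n₀‖) * 4 ^ (K + 1)
  set B := A * (2 / ρ) ^ (K + 1)
  have hbound (n : ℕ) (hn : n₀ ≤ n) (z : ℂ) (hz : ‖z - 1‖ ≤ ρ / 4) :
      ‖normalizedRemainder b g n z‖ ≤ B := by
    refine norm_le_of_norm_mul_abs_norm_sq_sub_one_pow_le hρ0 (by linarith) ?_ ?_ hz
    · refine DifferentiableOn.diffContOnCl ?_
      rw [closure_ball _ hρ0.ne']
      refine ((hgd.mono hsub).sub (by fun_prop)).div (by fun_prop) fun z hz => ?_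
      exact mul_ne_zero (hb n hn) (pow_ne_zero _ (hz0 z hz))
    · intro z hz
      have hz' := Metric.sphere_subset_closedBall hz
      refine norm_normalizedRemainder_mul_le h h' hn (hb _ le_rfl) (hb n hn) (hz0 z hz') ?_
        (hgs z hz') (hM z hz')
      rw [mem_closedBall_iff_norm] at hz'
      have := norm_sub_norm_le z 1
      rw [norm_one] at this
      linarith
  -- At `t = 1 - τ` the uniform bound `B` holds, while the limit has modulus `τ⁻¹ ≥ |B| + 1`.
  set τ := min (ρ / 4) (|B| + 1)⁻¹
  have hτ0 : 0 < τ := by positivity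
  have hτρ : τ ≤ ρ / 4 := min_le_left _ _
  have hτB : τ ≤ (|B| + 1)⁻¹ := min_le_right _ _
  set t : ℂ := ((1 - τ : ℝ) : ℂ)
  have htn : ‖t‖ = 1 - τ := by
    rw [Complex.norm_real, Real.norm_of_nonneg (by linarith)]
  have ht1 : ‖t - 1‖ = τ := by
    rw [show t - 1 = ((-τ : ℝ) : ℂ) by simp [t], Complex.norm_real, norm_neg,
      Real.norm_of_nonneg hτ0.le]
  have htb : t ∈ Metric.closedBall (1 : ℂ) ρ := by
    rw [mem_closedBall_iff_norm, ht1]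
    linarith
  have htlt : ‖t‖ < 1 := by rw [htn]; linarith
  have hNe := hN.eventually_ge_atTop n₀
  have hT : Tendsto (fun k => ∑' j, b (N k + j) / b (N k) * t ^ j) atTop
      (𝓝 (∑' j, (1 : ℂ) * t ^ j)) := by
    refine tendsto_tsum_of_dominated_convergence
      (hasSum_choose_mul_geometric_of_norm_lt_one K (r := ‖t‖) (by simpa using htlt)).summable
      (fun j => (hlim j).mul_const _) ?_
    filter_upwards [hNe] with k hk j
    rw [norm_mul, norm_div, norm_pow]
    gcongr
    rw [div_le_iff₀ (norm_pos_iff.2 (hb _ hk))]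
    exact norm_add_le_choose_mul h hk j
  have hle := le_of_tendsto hT.norm (b := B) (by
    filter_upwards [hNe] with k hk
    rw [(hasSum_normalizedRemainder h htlt (hz0 t htb) (hb _ hk) (hgs t htb htlt)).tsum_eq]
    exact hbound _ hk t (ht1.trans_le hτρ))
  simp only [one_mul] at hle
  rw [tsum_geometric_of_norm_lt_one htlt, norm_inv, norm_sub_rev, ht1] at hle
  have h1 : |B| + 1 ≤ τ⁻¹ := by
    rwa [le_inv_comm₀ (by positivity) hτ0]
  linarith [le_abs_self B]

theorem IsRegularPoint.rescale {a : ℕ → ℂ} {R : ℝ} {w : ℂ} (hR : 0 < R) (hw : ‖w‖ = R)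
    (h : IsRegularPoint a R w) : IsRegularPoint (fun n => a n * w ^ n) 1 1 := by
  obtain ⟨r, hr, g, hga, hg⟩ := h
  have hmaps : ∀ z ∈ Metric.ball (1 : ℂ) (r / R), w * z ∈ Metric.ball w r := by
    intro z hz
    rw [mem_ball_iff_norm] at hz ⊢
    rw [← mul_sub_one, norm_mul, hw]
    rwa [lt_div_iff₀' hR] at hz
  refine ⟨r / R, by positivity, fun z => g (w * z), fun z hz => ?_, fun z hz => ?_⟩
  · exact (hga _ (hmaps z hz)).comp_of_eq (by fun_prop) rfl
  · have hz1 : w * z ∈ Metric.ball (0 : ℂ) R := by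
      have := hz.2
      rw [mem_ball_zero_iff] at this ⊢
      rw [norm_mul, hw]
      exact mul_lt_of_lt_one_right hR this
    simp only [hg _ ⟨hmaps z hz.1, hz1⟩]
    simp only [powerSeriesSum, mul_pow, mul_assoc]

/-- Take `N k` to be the integer part of `exp (x k)`, where `c * x k` is congruent to `θ` modulo
`2π`. Rounding and the shift by `j` change the logarithm by `o(1)`. Dividing by `|c|` sends `x k` to
`+∞` for either sign of `c`. -/
theorem exists_tendsto_atTop_exp_log_add (θ : ℝ) {c : ℝ} (hc : c ≠ 0) :
    ∃ N : ℕ → ℕ, Tendsto N atTop atTop ∧ ∀ j : ℕ, Tendsto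
      (fun k => Complex.exp (Complex.I * (θ - c * Real.log (N k + j : ℕ)))) atTop (𝓝 1) := by
  set x : ℕ → ℝ := fun k => θ / c + k * (2 * Real.pi / |c|) with hx
  have hxt : Tendsto x atTop atTop :=
    tendsto_atTop_add_const_left _ _
      (tendsto_natCast_atTop_atTop.atTop_mul_const (by have := Real.pi_pos; positivity))
  have het : Tendsto (fun k => Real.exp (x k)) atTop atTop := Real.tendsto_exp_atTop.comp hxt
  refine ⟨fun k => ⌊Real.exp (x k)⌋₊, tendsto_nat_floor_atTop.comp het, fun j => ?_⟩
  have h1 : Tendsto (fun k => (((⌊Real.exp (x k)⌋₊ + j : ℕ) : ℝ)) / Real.exp (x k))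
      atTop (𝓝 1) := by
    have h2 := (tendsto_nat_floor_div_atTop (R := ℝ)).comp het
    have h3 := (tendsto_const_nhds (x := (j : ℝ))).div_atTop het
    have h4 := h2.add h3
    rw [add_zero] at h4
    refine h4.congr fun k => ?_
    simp only [Function.comp_apply]
    push_cast
    rw [add_div]
  have h5 := (Real.continuousAt_log one_ne_zero).tendsto.comp h1
  rw [Real.log_one] at h5
  have h6 : Tendsto (fun k => Complex.exp (-(Complex.I * c) *
      ((Real.log (((⌊Real.exp (x k)⌋₊ + j : ℕ) : ℝ) / Real.exp (x k)) : ℝ) : ℂ))) atTop (𝓝 1) := by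
    have := ((Complex.continuous_ofReal.tendsto 0).comp h5).const_mul (-(Complex.I * c))
    simpa using this.cexp
  refine h6.congr' ?_
  have hpos : ∀ᶠ k in atTop, 0 < ⌊Real.exp (x k)⌋₊ :=
    (tendsto_nat_floor_atTop.comp het).eventually_gt_atTop 0
  filter_upwards [hpos] with k hk
  have hne : ((⌊Real.exp (x k)⌋₊ + j : ℕ) : ℝ) ≠ 0 := by
    exact_mod_cast (by omega : ⌊Real.exp (x k)⌋₊ + j ≠ 0)
  rw [Real.log_div hne (Real.exp_ne_zero _), Real.log_exp]
  obtain ⟨m, hm⟩ : ∃ m : ℤ, c * x k = θ + m * (2 * Real.pi) := by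
    rcases lt_or_gt_of_ne hc with h | h
    · refine ⟨-k, ?_⟩
      simp only [hx]
      rw [abs_of_neg h]
      push_cast
      field_simp
    · refine ⟨k, ?_⟩
      simp only [hx]
      rw [abs_of_pos h]
      push_cast
      field_simp
  have hm' : (c : ℂ) * (x k : ℂ) = θ + m * (2 * Real.pi) := by exact_mod_cast hm
  rw [← Complex.exp_periodic.int_mul (-m)]
  congr 1
  push_cast
  linear_combination Complex.I * hm'

theorem isBigO_inv_sub_one {f : ℕ → ℂ} {g : ℕ → ℝ} (hg : Tendsto g atTop (𝓝 0))
    (h : (fun n => f n - 1) =O[atTop] g) : (fun n => (f n)⁻¹ - 1) =O[atTop] g := by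
  have hf : Tendsto f atTop (𝓝 1) := by
    simpa using (h.trans_tendsto hg).add_const 1
  have hinv : (fun n => (f n)⁻¹) =O[atTop] fun _ => (1 : ℝ) :=
    (hf.inv₀ one_ne_zero).isBigO_one ℝ
  have h2 := (h.mul hinv).neg_left
  simp only [mul_one] at h2
  refine h2.congr' ?_ EventuallyEq.rfl
  filter_upwards [hf.eventually_ne one_ne_zero] with n hn
  field_simp
  ring

theorem not_isRegularPoint_one_of_isBigO {b : ℕ → ℂ} {θ c : ℝ} (hc : c ≠ 0)
    (hb : ∀ᶠ n in atTop, b n ≠ 0)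
    (h : (fun n : ℕ => b (n + 1) / b n * Complex.exp (-(Complex.I * (θ - c * Real.log n))) - 1)
      =O[atTop] fun n : ℕ => (n : ℝ)⁻¹) :
    ¬ IsRegularPoint b 1 1 := by
  set f : ℕ → ℂ := fun n =>
    b (n + 1) / b n * Complex.exp (-(Complex.I * (θ - c * Real.log n))) with hf
  have h0 : Tendsto (fun n : ℕ => (n : ℝ)⁻¹) atTop (𝓝 0) := tendsto_inv_atTop_nhds_zero_nat
  have hinv := isBigO_inv_sub_one h0 h
  have hft : Tendsto f atTop (𝓝 1) := by
    have h1 := (h.trans_tendsto h0).add_const 1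
    simp only [sub_add_cancel, zero_add] at h1
    exact h1
  have hfb (n : ℕ) : b (n + 1) / b n = f n * Complex.exp (Complex.I * (θ - c * Real.log n)) := by
    rw [hf]
    simp only
    rw [mul_assoc, ← Complex.exp_add, neg_add_cancel, Complex.exp_zero, mul_one]
  have hnorm (n : ℕ) : ‖f n‖ = ‖b (n + 1)‖ / ‖b n‖ := by
    have h1 : ‖Complex.exp (-(Complex.I * (θ - c * Real.log n)))‖ = 1 := by
      rw [show -(Complex.I * (θ - c * Real.log n)) =
        ((-(θ - c * Real.log n) : ℝ) : ℂ) * Complex.I by push_cast; ring]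
      exact Complex.norm_exp_ofReal_mul_I _
    rw [hf]
    simp only
    rw [norm_mul, h1, mul_one, norm_div]
  obtain ⟨C, hC, h1⟩ := h.exists_pos
  obtain ⟨C', hC', h2⟩ := hinv.exists_pos
  obtain ⟨n₀, hn₀⟩ := eventually_atTop.1
    ((hb.and (eventually_gt_atTop 0)).and (h1.bound.and h2.bound))
  -- The factor `2` comes from `1 / n ≤ 2 / (n + 1)`; `C` and `C'` serve the ratio and its inverse.
  obtain ⟨K, hK⟩ := exists_nat_ge (2 * C + 2 * C')
  have hle {n : ℕ} (hn : 0 < n) {D : ℝ} (hD : 2 * D ≤ K) (hD0 : 0 ≤ D) {y : ℂ}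
      (hy : ‖y - 1‖ ≤ D * ‖(n : ℝ)⁻¹‖) : ‖y‖ ≤ 1 + K / (n + 1) := by
    have hn' : (1 : ℝ) ≤ n := by exact_mod_cast hn
    have h3 : ‖y‖ ≤ 1 + ‖y - 1‖ := by
      have := norm_add_le 1 (y - 1)
      rwa [add_sub_cancel, norm_one] at this
    refine h3.trans ?_
    gcongr
    refine hy.trans ?_
    rw [norm_inv, Real.norm_of_nonneg (by linarith), ← div_eq_mul_inv,
      div_le_div_iff₀ (by linarith) (by linarith)]
    nlinarith
  obtain ⟨N, hN, hNj⟩ := exists_tendsto_atTop_exp_log_add θ hc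
  refine not_isRegularPoint_one_of_tendsto_div (K := K) (n₀ := n₀)
    (fun n hn => (hn₀ n hn).1.1) (fun n hn => ?_) (fun n hn => ?_) hN fun j => ?_
  · have hbn := norm_pos_iff.2 (hn₀ n hn).1.1
    have := hle (hn₀ n hn).1.2 (by linarith) hC.le (hn₀ n hn).2.1
    rwa [hnorm, div_le_iff₀ hbn] at this
  · have hbn := norm_pos_iff.2 (hn₀ (n + 1) (by omega)).1.1
    have := hle (hn₀ n hn).1.2 (by linarith) hC'.le (hn₀ n hn).2.2
    rwa [norm_inv, hnorm, inv_div, div_le_iff₀ hbn] at this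
  -- Each further ratio, at index `N k + j`, tends to `1` because its phase does.
  · induction j with
    | zero =>
      refine tendsto_const_nhds.congr' ?_
      filter_upwards [hN.eventually_ge_atTop n₀] with k hk
      rw [add_zero, div_self (hn₀ _ hk).1.1]
    | succ j ih =>
      have hNj' : Tendsto (fun k => N k + j) atTop atTop := 
        tendsto_atTop_mono (fun k => Nat.le_add_right _ _) hN
      have h3 := ((hft.comp hNj').mul (hNj j)).mul ih
      simp only [mul_one] at h3
      refine h3.congr' ?_
      filter_upwards [hN.eventually_ge_atTop n₀] with k hk
      simp only [Function.comp_apply]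
      rw [← hfb, add_assoc]
      have := (hn₀ (N k + j) (by omega)).1.1
      field_simp

/-! ### The reciprocal Gamma coefficients -/

/-- With `a = ic`, the Gamma quotient estimate applies at `s = u + a * n`, where `log s = log n +
log (a + u / n)`; replacing the last logarithm by `log a` costs `O(1/n)`. -/
theorem Complex.isBigO_Gamma_div_mul_exp_sub_one (u : ℂ) {c : ℝ} (hc : c ≠ 0) :
    (fun n : ℕ => Complex.Gamma (u + Complex.I * c * (n + 1 : ℕ)) /
        Complex.Gamma (u + Complex.I * c * n) *
        Complex.exp (-(Complex.I * c * (Real.log n + Complex.log (Complex.I * c)))) - 1)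
      =O[atTop] fun n : ℕ => (n : ℝ)⁻¹ := by
  set a : ℂ := Complex.I * c with ha
  have h0 : Tendsto (fun n : ℕ => (n : ℝ)⁻¹) atTop (𝓝 0) := tendsto_inv_atTop_nhds_zero_nat
  obtain ⟨C, Y, hC, hY, hCY⟩ := Complex.exists_norm_Gamma_add_div_Gamma_sub_one_le a
  have him (n : ℕ) : (u + a * n).im = u.im + c * n := by simp [ha]
  have hre (n : ℕ) : (u + a * n).re = u.re := by simp [ha]
  have hc0 : 0 < |c| := abs_pos.2 hc
  have hlarge : ∀ᶠ n : ℕ in atTop, Y + 2 * |u.re| + |u.im| ≤ |c| * n / 2 := by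
    have : Tendsto (fun n : ℕ => |c| * n / 2) atTop atTop :=
      (tendsto_natCast_atTop_atTop.const_mul_atTop hc0).atTop_div_const two_pos
    exact this.eventually_ge_atTop _
  have h1 : (fun n : ℕ => Complex.Gamma (u + a * n + a) / Complex.Gamma (u + a * n) *
      Complex.exp (-(a * Complex.log (u + a * n))) - 1) =O[atTop] fun n : ℕ => (n : ℝ)⁻¹ := by
    refine IsBigO.of_bound (C * (2 / |c|)) ?_
    filter_upwards [hlarge, eventually_gt_atTop 0] with n hn hn0
    have hn0' : (0 : ℝ) < n := by exact_mod_cast hn0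
    have hge : |c| * n / 2 ≤ |(u + a * n).im| := by
      rw [him]
      have := abs_sub_abs_le_abs_sub (c * n) (-u.im)
      rw [abs_neg, sub_neg_eq_add, abs_mul, abs_of_pos hn0', add_comm (c * n)] at this
      linarith [abs_nonneg u.re]
    have hu := abs_nonneg u.re
    have hu' := abs_nonneg u.im
    refine (hCY _ (by linarith) (by rw [hre]; linarith)).trans ?_
    rw [Real.norm_of_nonneg (by positivity)]
    calc C / |(u + a * n).im| ≤ C / (|c| * n / 2) := by gcongr
      _ = _ := by field_simp
  have hslit : a ∈ Complex.slitPlane := by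
    refine Or.inr ?_
    simp [ha, hc]
  have hu0 : Tendsto (fun n : ℕ => u / n) atTop (𝓝 0) := tendsto_const_div_atTop_nhds_zero_nat u
  have hau : Tendsto (fun n : ℕ => a + u / n) atTop (𝓝 a) := by simpa using hu0.const_add a
  have huO : (fun n : ℕ => u / n) =O[atTop] fun n : ℕ => (n : ℝ)⁻¹ := by
    refine IsBigO.of_bound ‖u‖ (Eventually.of_forall fun n => ?_)
    simp [div_eq_mul_inv]
  have h2 : (fun n : ℕ => Complex.log (a + u / n) - Complex.log a) =O[atTop]
      fun n : ℕ => (n : ℝ)⁻¹ := by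
    have h3 := (Complex.hasDerivAt_log hslit).isBigO_sub.comp_tendsto hau
    refine IsBigO.trans ?_ huO
    simpa [Function.comp_def] using h3
  have h4 : (fun n : ℕ => Complex.exp (a * (Complex.log (a + u / n) - Complex.log a)) - 1)
      =O[atTop] fun n : ℕ => (n : ℝ)⁻¹ := by
    have h5 := h2.const_mul_left a
    have h6 : (fun x : ℂ => Complex.exp x - 1) =O[𝓝 0] fun x => x := by
      simpa using (Complex.hasDerivAt_exp 0).isBigO_sub
    exact (h6.comp_tendsto (h5.trans_tendsto h0)).trans h5
  have hexp1 : Tendsto (fun n : ℕ => Complex.exp (a * (Complex.log (a + u / n) - Complex.log a)))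
      atTop (𝓝 1) := by
    have := (h4.trans_tendsto h0).add_const 1
    simpa only [sub_add_cancel, zero_add] using this
  -- Uses `f * e - 1 = (f - 1) * e + (e - 1)`.
  have h7 := (h1.mul (hexp1.isBigO_one ℝ)).congr_right (fun n => mul_one _) |>.add h4
  refine h7.congr' ?_ EventuallyEq.rfl
  filter_upwards [hlarge, eventually_gt_atTop 0] with n hn hn0
  have hn0' : (0 : ℝ) < n := by exact_mod_cast hn0
  have hnC : (n : ℂ) ≠ 0 := by exact_mod_cast hn0.ne'
  have hlog : Complex.log (u + a * n) = Real.log n + Complex.log (a + u / n) := by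
    have e : u + a * n = ((n : ℝ) : ℂ) * (a + u / n) := by
      push_cast
      field_simp
      ring
    have hne : u + a * n ≠ 0 := by
      intro h
      have h8 := congrArg Complex.im h
      rw [him, Complex.zero_im] at h8
      have h9 : |c| * n = |u.im| := by
        rw [eq_neg_of_add_eq_zero_left h8, abs_neg, abs_mul, abs_of_pos hn0']
      have := abs_nonneg u.re
      have := abs_nonneg u.im
      linarith
    rw [e, Complex.log_ofReal_mul hn0']
    rw [e] at hne
    exact right_ne_zero_of_mul hne
  rw [sub_mul, one_mul, sub_add_sub_cancel, mul_assoc, ← Complex.exp_add, hlog]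
  have e1 : u + a * ((n + 1 : ℕ) : ℂ) = u + a * n + a := by
    push_cast
    ring
  rw [e1]
  congr 3
  ring

theorem Complex.mul_arg_I_mul (c : ℝ) :
    c * Complex.arg (Complex.I * c) = |c| * (Real.pi / 2) := by
  rcases lt_trichotomy c 0 with h | rfl | h
  · rw [show Complex.I * c = ((-c : ℝ) : ℂ) * (-Complex.I) by push_cast; ring,
      Complex.arg_real_mul _ (by linarith), Complex.arg_neg_I, abs_of_neg h]
    ring
  · simp
  · rw [mul_comm Complex.I, Complex.arg_real_mul _ h, Complex.arg_I, abs_of_pos h]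

/-- For `c ≠ 0`, this is the limit of the moduli of the coefficient ratios, hence the reciprocal of
the radius. -/
theorem Complex.norm_exp_neg_I_mul_mul_log (c : ℝ) :
    ‖Complex.exp (-(Complex.I * c * Complex.log (Complex.I * c)))‖ =
      Real.exp (|c| * (Real.pi / 2)) := by
  rw [Complex.norm_exp, ← Complex.mul_arg_I_mul]
  congr 1
  simp [Complex.log_im]

theorem hasNaturalBoundaryCircle_Gamma_inv (u : ℂ) {c : ℝ} (hc : c ≠ 0) :
    HasNaturalBoundaryCircle (fun n : ℕ => (Complex.Gamma (u + Complex.I * c * n))⁻¹)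
      (Real.exp (-(|c| * (Real.pi / 2)))) := by
  set R := Real.exp (-(|c| * (Real.pi / 2))) with hR
  have hR0 : 0 < R := Real.exp_pos _
  set a : ℕ → ℂ := fun n => (Complex.Gamma (u + Complex.I * c * n))⁻¹ with ha
  have h0 : Tendsto (fun n : ℕ => (n : ℝ)⁻¹) atTop (𝓝 0) := tendsto_inv_atTop_nhds_zero_nat
  have hO := isBigO_inv_sub_one h0 (Complex.isBigO_Gamma_div_mul_exp_sub_one u hc)
  set E := Complex.exp (Complex.I * c * Complex.log (Complex.I * c)) with hE
  have hEn : ‖E‖ = R := by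
    rw [hR, Real.exp_neg, ← Complex.norm_exp_neg_I_mul_mul_log, Complex.exp_neg, norm_inv, inv_inv]
  have hO' : (fun n : ℕ => a (n + 1) / a n * Complex.exp (Complex.I * c * Real.log n) * E - 1)
      =O[atTop] fun n : ℕ => (n : ℝ)⁻¹ := by
    refine hO.congr_left fun n => ?_
    rw [mul_inv, ← Complex.exp_neg, neg_neg, mul_add, Complex.exp_add, ← mul_assoc, inv_div]
    simp only [ha, hE, div_eq_mul_inv, inv_inv]
    ring
  -- A coefficient can vanish only if `u + I * c * n` is real, which happens for at most one `n`.
  have hne : ∀ᶠ n in atTop, a n ≠ 0 := by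
    obtain ⟨n₀, hn₀⟩ := exists_nat_gt (|u.im| / |c|)
    filter_upwards [eventually_ge_atTop n₀] with n hn
    refine inv_ne_zero (Complex.Gamma_ne_zero_of_im_ne_zero fun h => ?_)
    have h1 : u.im + c * n = 0 := by simpa using h
    have h2 : |u.im| = |c| * n := by
      rw [eq_neg_of_add_eq_zero_left h1, abs_neg, abs_mul, Nat.abs_cast]
    rw [h2, mul_div_cancel_left₀ _ (abs_ne_zero.2 hc)] at hn₀
    have : (n₀ : ℝ) ≤ n := by exact_mod_cast hn
    linarith
  refine ⟨hR0, ?_, fun w hw hreg => ?_⟩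
  · have hlim : Tendsto (fun n => ‖a n.succ‖ / ‖a n‖) atTop
        (𝓝 ((R.toNNReal⁻¹ : NNReal) : ℝ)) := by
      have h1 := ((hO'.trans_tendsto h0).add_const 1).norm.div_const R
      simp only [sub_add_cancel, zero_add, norm_one, one_div] at h1
      rw [NNReal.coe_inv, Real.coe_toNNReal _ hR0.le]
      refine h1.congr fun n => ?_
      have h2 : ‖Complex.exp (Complex.I * c * Real.log n)‖ = 1 := by
        rw [show Complex.I * c * Real.log n = ((c * Real.log n : ℝ) : ℂ) * Complex.I by
          push_cast; ring]
        exact Complex.norm_exp_ofReal_mul_I _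
      rw [norm_mul, norm_mul, h2, hEn, mul_one, mul_div_cancel_right₀ _ hR0.ne', norm_div]
    rw [FormalMultilinearSeries.ofScalars_radius_eq_inv_of_tendsto ℂ a
      (inv_ne_zero (Real.toNNReal_pos.2 hR0).ne') hlim, inv_inv, ENNReal.ofReal]
  · have hw0 : w ≠ 0 := norm_pos_iff.1 (hw ▸ hR0)
    -- The rescaled ratios behave like `w * E⁻¹ * exp(-ic log n)`, and `w * E⁻¹` has modulus `1`.
    refine not_isRegularPoint_one_of_isBigO (θ := Complex.arg (w * E⁻¹)) hc ?_ ?_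
      (hreg.rescale hR0 hw)
    · filter_upwards [hne] with n hn
      exact mul_ne_zero hn (pow_ne_zero _ hw0)
    · have hθ : Complex.exp (Complex.arg (w * E⁻¹) * Complex.I) = w * E⁻¹ := by
        have h1 := Complex.norm_mul_exp_arg_mul_I (w * E⁻¹)
        rwa [norm_mul, norm_inv, hEn, hw, mul_inv_cancel₀ hR0.ne', Complex.ofReal_one,
          one_mul] at h1
      refine hO'.congr_left fun n => ?_
      have e : -(Complex.I * (Complex.arg (w * E⁻¹) - c * Real.log n)) =
          -(Complex.arg (w * E⁻¹) * Complex.I) + Complex.I * c * Real.log n := by ring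
      rw [e, Complex.exp_add, Complex.exp_neg, hθ, mul_inv, inv_inv, pow_succ',
        ← mul_assoc (a (n + 1)) w,
        mul_div_mul_right _ _ (pow_ne_zero n hw0), mul_div_right_comm, mul_assoc _ w, mul_assoc w⁻¹,
        mul_inv_cancel_left₀ hw0]
      ring

/-- Here `(Complex.Gamma s)⁻¹` is the entire function `1 / Γ`, since `Complex.Gamma` takes the
value `0` at the poles of `Γ`. -/
theorem mainTheorem4 :
    (∀ (u : ℂ) (v : ℝ), v ≠ 0 →
      HasNaturalBoundaryCircle
        (fun n : ℕ => (Complex.Gamma (u + 2 * Complex.I * (v : ℂ) * (n : ℂ) / (Real.pi : ℂ)))⁻¹)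
        (Real.exp (-|v|))) ∧
    HasNaturalBoundaryCircle
      (fun n : ℕ => (Complex.Gamma (1 + (n : ℂ) * Complex.I))⁻¹)
      (Real.exp (-(Real.pi / 2))) := by
  refine ⟨fun u v hv => ?_, ?_⟩
  · have hπ := Real.pi_pos
    -- This `c` gives `|c| * (π / 2) = |v|`.
    have h := hasNaturalBoundaryCircle_Gamma_inv u (c := 2 * v / Real.pi) (by positivity)
    convert h using 1
    · funext n
      congr 3
      push_cast
      ring
    · rw [abs_div, abs_mul, abs_two, abs_of_pos hπ]
      congr 2
      field_simp
  · have h := hasNaturalBoundaryCircle_Gamma_inv 1 one_ne_zero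
    simpa [mul_comm] using h
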